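/- There is an absolute constant $C>0$ with the following property. Let $m\ge 1$, let $z_1,\dots,z_m$ be any $m$ distinct complex numbers with $|z_k|=1$, and let $(z_n)_{n\ge1}$ be any sequence on the unit circle that continues them greedily (a Leja sequence): for every $N\ge m$, $z_{N+1}$ is a point at which $|p_N(z)|=\prod_{k=1}^{N}|z-z_k|$ attains its maximum over $|z|=1$ (any such point is allowed if there are several). Write $z_k=e^{2\pi i x_k}$ with $x_k\in[0,1]$, and set $$F_n(x)=\frac1n\sum_{k=1}^{n} f(x-x_k),\qquad f(x)=\frac12-\{x\},\qquad \{x\}=x-\lfloor x\rfloor .$$ Then there is an $N_0$ (which may depend on the sequence) such that for all $N\ge N_0$ $$\frac1N\sum_{n=1}^{N} n\,\|F_n\|_{L^1}\le C(\log N)^2,\qquad \|F_n\|_{L^1}=\int_0^1|F_n(x)|\,dx .$$ -/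

import Mathlib

/-- The monic polynomial `∏ (X - z_k)` whose roots are the first `N` terms `z 0, …, z (N - 1)`
of the sequence `z`. -/
noncomputable def lejaPoly (z : ℕ → ℂ) (N : ℕ) : Polynomial ℂ :=
  ∏ k ∈ Finset.range N, (Polynomial.X - Polynomial.C (z k))

/-- `z` is a Leja sequence on the unit circle started from `m` distinct points: all terms lie on
the unit circle, the first `m` terms `z 0, …, z (m - 1)` are pairwise distinct and otherwise
arbitrary, and each later term is a point of the unit circle (any one, in case of ties) at which
the modulus of the polynomial with the preceding terms as roots attains its maximum over the
unit circle. Terms are indexed from `0`. -/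
structure IsLejaSequence (m : ℕ) (z : ℕ → ℂ) : Prop where
  mem_circle : ∀ k, z k ∈ Metric.sphere (0 : ℂ) 1
  distinct : Set.InjOn z (Set.Iio m)
  greedy : ∀ N, m ≤ N →
    IsMaxOn (fun w : ℂ => ‖(lejaPoly z N).eval w‖) (Metric.sphere (0 : ℂ) 1) (z N)

/-- The one-periodic sawtooth function `1/2 - {x}`. -/
noncomputable def sawtooth (x : ℝ) : ℝ := 1 / 2 - Int.fract x

/-- `F_n(t) = (1/n) ∑ f(t - x_k)`, the sum running over the first `n` terms of the sequence `x`
and `f` being the sawtooth. -/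
noncomputable def sawtoothMean (x : ℕ → ℝ) (n : ℕ) (t : ℝ) : ℝ :=
  (1 / (n : ℝ)) * ∑ k ∈ Finset.range n, sawtooth (t - x k)

/-- The `L¹` norm over one period `[0, 1]` of a real function. -/
noncomputable def normL1 (g : ℝ → ℝ) : ℝ := ∫ t in (0 : ℝ)..1, |g t|

theorem Real.le_cos_mul_one_sub {a δ : ℝ} (ha : |a| ≤ Real.pi / 2) (h0 : 0 ≤ δ) (h1 : δ ≤ 1) :
    δ ≤ Real.cos (a * (1 - δ)) := by
  have hpi := Real.pi_pos
  have hle : |a * (1 - δ)| ≤ Real.pi / 2 - Real.pi / 2 * δ := by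
    rw [abs_mul, abs_of_nonneg (by linarith : (0 : ℝ) ≤ 1 - δ)]
    nlinarith
  calc δ = 2 / Real.pi * (Real.pi / 2 * δ) := by field_simp
    _ ≤ Real.sin (Real.pi / 2 * δ) :=
      Real.mul_le_sin (by positivity) (by nlinarith)
    _ = Real.cos (Real.pi / 2 - Real.pi / 2 * δ) := (Real.cos_pi_div_two_sub _).symm
    _ ≤ Real.cos |a * (1 - δ)| :=
      Real.cos_le_cos_of_nonneg_of_le_pi (abs_nonneg _) (by nlinarith [mul_nonneg hpi.le h0]) hle
    _ = _ := Real.cos_abs _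

theorem Complex.mul_norm_rpow_le_re_cpow {w : ℂ} (hw : 0 ≤ w.re) {δ : ℝ} (h0 : 0 ≤ δ)
    (h1 : δ ≤ 1) : δ * ‖w‖ ^ (1 - δ) ≤ (w ^ ((1 - δ : ℝ) : ℂ)).re := by
  rw [Complex.cpow_ofReal_re, mul_comm]
  gcongr
  exact Real.le_cos_mul_one_sub (Complex.abs_arg_le_pi_div_two_iff.2 hw) h0 h1

/-- Kolmogorov's inequality for the `p`-th mean (`p = 1 - δ`) of a holomorphic function with
positive real part. -/
theorem circleAverage_norm_rpow_le {G : ℂ → ℂ} {r A δ : ℝ} (hr : |r| < 1)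
    (hG : DifferentiableOn ℂ G (Metric.ball 0 1)) (hpos : ∀ w ∈ Metric.ball (0 : ℂ) 1, 0 < (G w).re)
    (hA : 0 ≤ A) (hG0 : G 0 = A) (h0 : 0 < δ) (h1 : δ ≤ 1) :
    Real.circleAverage (fun w => ‖G w‖ ^ (1 - δ)) 0 r ≤ A ^ (1 - δ) / δ := by
  have hsub : Metric.closedBall (0 : ℂ) |r| ⊆ Metric.ball 0 1 :=
    Metric.closedBall_subset_ball hr
  have hsph : Metric.sphere (0 : ℂ) |r| ⊆ Metric.ball 0 1 :=
    Metric.sphere_subset_closedBall.trans hsub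
  have hd : DifferentiableOn ℂ (fun w => G w ^ ((1 - δ : ℝ) : ℂ)) (Metric.ball 0 1) :=
    hG.cpow_const fun w hw => Or.inl (hpos w hw)
  have hint : CircleIntegrable (fun w => G w ^ ((1 - δ : ℝ) : ℂ)) 0 r :=
    (hd.continuousOn.mono hsph).circleIntegrable'
  have hmean : Real.circleAverage (fun w => G w ^ ((1 - δ : ℝ) : ℂ)) 0 r = ((A ^ (1 - δ) : ℝ) : ℂ) := by
    rw [DiffContOnCl.circleAverage, hG0, Complex.ofReal_cpow hA]
    exact (hd.mono (closure_minimal Metric.ball_subset_closedBall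
      Metric.isClosed_closedBall |>.trans hsub)).diffContOnCl
  have hre : Real.circleAverage (fun w => (G w ^ ((1 - δ : ℝ) : ℂ)).re) 0 r = A ^ (1 - δ) := by
    have := Complex.reCLM.circleAverage_comp_comm hint
    rw [hmean] at this
    simpa [Function.comp_def] using this
  rw [le_div_iff₀' h0, ← hre, ← smul_eq_mul, ← Real.circleAverage_fun_smul]
  refine Real.circleAverage_mono ?_ ?_ fun w hw => ?_
  · exact (((hG.continuousOn.mono hsph).norm.rpow_const
      fun _ _ => Or.inr (sub_nonneg.2 h1)).const_smul δ).circleIntegrable'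
  · exact (Complex.continuous_re.comp_continuousOn (hd.continuousOn.mono hsph)).circleIntegrable'
  · exact Complex.mul_norm_rpow_le_re_cpow (hpos w (hsph hw)).le h0.le h1

theorem circleAverage_abs_im_le {G : ℂ → ℂ} {r A B δ : ℝ} (hr : |r| < 1)
    (hG : DifferentiableOn ℂ G (Metric.ball 0 1)) (hpos : ∀ w ∈ Metric.ball (0 : ℂ) 1, 0 < (G w).re)
    (hA : 0 ≤ A) (hG0 : G 0 = A) (h0 : 0 < δ) (h1 : δ ≤ 1)
    (him : ∀ w ∈ Metric.ball (0 : ℂ) 1, |(G w).im| ≤ B) :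
    Real.circleAverage (fun w => |(G w).im|) 0 r ≤ B ^ δ * (A ^ (1 - δ) / δ) := by
  have hsph : Metric.sphere (0 : ℂ) |r| ⊆ Metric.ball 0 1 :=
    Metric.sphere_subset_closedBall.trans (Metric.closedBall_subset_ball hr)
  have hB : 0 ≤ B := (abs_nonneg _).trans (him 0 (by simp))
  refine le_trans ?_ (mul_le_mul_of_nonneg_left
    (circleAverage_norm_rpow_le hr hG hpos hA hG0 h0 h1) (by positivity))
  rw [← smul_eq_mul, ← Real.circleAverage_fun_smul]
  have hc := hG.continuousOn.mono hsph
  refine Real.circleAverage_mono ?_ ?_ fun w hw => ?_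
  · exact (Complex.continuous_im.comp_continuousOn hc).abs.circleIntegrable'
  · exact ((hc.norm.rpow_const fun _ _ => Or.inr (sub_nonneg.2 h1)).const_smul
      (B ^ δ)).circleIntegrable'
  · calc |(G w).im| = |(G w).im| ^ δ * |(G w).im| ^ (1 - δ) := by
          rw [← Real.rpow_add_of_nonneg (abs_nonneg _) h0.le (by linarith)]; simp
      _ ≤ B ^ δ * ‖G w‖ ^ (1 - δ) := by
          gcongr
          · exact him w (hsph hw)
          · exact Complex.abs_im_le_norm _

theorem circleAverage_eq_integral_unitInterval (f : ℂ → ℝ) (r : ℝ) :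
    Real.circleAverage f 0 r =
      ∫ t in (0 : ℝ)..1, f (r * Complex.exp (2 * Real.pi * Complex.I * t)) := by
  have := intervalIntegral.smul_integral_comp_mul_left (a := 0) (b := 1)
    (fun θ => f (circleMap 0 r θ)) (2 * Real.pi)
  rw [Real.circleAverage_def]
  simp only [mul_zero, mul_one] at this
  rw [← this, smul_smul, inv_mul_cancel₀ (by positivity), one_smul]
  refine intervalIntegral.integral_congr fun t _ => ?_
  simp only [circleMap]
  congr 1
  push_cast
  ring_nf

theorem Complex.arg_one_sub_exp {t : ℝ} (ht : Int.fract t ≠ 0) :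
    Complex.arg (1 - Complex.exp (2 * Real.pi * Complex.I * t)) = -Real.pi * sawtooth t := by
  have hpi := Real.pi_pos
  set s := Int.fract t with hs
  have hs0 : 0 < s := lt_of_le_of_ne (Int.fract_nonneg t) (Ne.symm ht)
  have hs1 : s < 1 := Int.fract_lt_one t
  have hexp : Complex.exp (2 * Real.pi * Complex.I * t) = Complex.exp (2 * (Real.pi * s : ℝ) * Complex.I) := by
    rw [Complex.exp_eq_exp_iff_exists_int]
    refine ⟨⌊t⌋, ?_⟩
    have : (t : ℂ) = ⌊t⌋ + s := by exact_mod_cast (Int.floor_add_fract t).symm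
    rw [this]; push_cast; ring
  have hpolar : 1 - Complex.exp (2 * (Real.pi * s : ℝ) * Complex.I) =
      ((2 * Real.sin (Real.pi * s) : ℝ) : ℂ) *
        (Complex.cos ((Real.pi * s - Real.pi / 2 : ℝ) : ℂ) +
          Complex.sin ((Real.pi * s - Real.pi / 2 : ℝ) : ℂ) * Complex.I) := by
    rw [← Complex.ofReal_cos, ← Complex.ofReal_sin, Real.cos_sub_pi_div_two,
      Real.sin_sub_pi_div_two, Complex.exp_mul_I]
    have h2 : (2 * ((Real.pi * s : ℝ) : ℂ)) = ((2 * (Real.pi * s) : ℝ) : ℂ) := by push_cast; ring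
    rw [h2, ← Complex.ofReal_cos, ← Complex.ofReal_sin, Real.cos_two_mul, Real.sin_two_mul]
    have := Real.sin_sq_add_cos_sq (Real.pi * s)
    generalize Real.sin (Real.pi * s) = a at *
    generalize Real.cos (Real.pi * s) = b at *
    apply Complex.ext
    · simp only [Complex.sub_re, Complex.add_re, Complex.one_re, Complex.re_ofReal_mul,
        Complex.ofReal_re, Complex.I_re]
      linarith
    · simp only [Complex.sub_im, Complex.add_im, Complex.one_im, Complex.im_ofReal_mul,
        Complex.ofReal_im, Complex.I_im]
      ring
  rw [hexp, hpolar, Complex.arg_mul_cos_add_sin_mul_I, sawtooth]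
  · ring
  · have := Real.sin_pos_of_pos_of_lt_pi (x := Real.pi * s) (by positivity) (by nlinarith)
    positivity
  · constructor <;> nlinarith

theorem Complex.one_sub_exp_mem_slitPlane {t : ℝ} (ht : Int.fract t ≠ 0) :
    1 - Complex.exp (2 * Real.pi * Complex.I * t) ∈ Complex.slitPlane := by
  rw [Complex.mem_slitPlane_iff_arg, Complex.arg_one_sub_exp ht]
  refine ⟨?_, fun h => ?_⟩
  · have := Real.pi_pos
    have h1 := Int.fract_lt_one t
    rw [sawtooth]
    nlinarith
  · obtain ⟨k, hk⟩ := Complex.exp_eq_one_iff.1 (sub_eq_zero.1 h).symm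
    rw [mul_comm (k : ℂ)] at hk
    have : t = k := by exact_mod_cast mul_left_cancel₀ Complex.two_pi_I_ne_zero hk
    exact ht (by rw [this, Int.fract_intCast])

theorem Matrix.norm_det_le_factorial {N : ℕ} {A : Matrix (Fin N) (Fin N) ℂ}
    (hA : ∀ i j, ‖A i j‖ ≤ 1) : ‖A.det‖ ≤ N.factorial := by
  have := Matrix.det_le (A := A) (abv := NormedField.toAbsoluteValue ℂ) (x := 1) hA
  rw [one_pow, Fintype.card_fin, nsmul_one] at this
  exact this

theorem norm_eval_lejaPoly (z : ℕ → ℂ) (N : ℕ) (w : ℂ) :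
    ‖(lejaPoly z N).eval w‖ = ∏ k ∈ Finset.range N, ‖w - z k‖ := by
  simp [lejaPoly, Polynomial.eval_prod]

theorem prod_norm_eval_lejaPoly_eq_norm_det_vandermonde (z : ℕ → ℂ) (N : ℕ) :
    ∏ n ∈ Finset.range N, ‖(lejaPoly z n).eval (z n)‖ =
      ‖(Matrix.vandermonde fun i : Fin N => z i).det‖ := by
  rw [Matrix.det_vandermonde, Finset.prod_comm' (t' := Finset.univ) (s' := fun j => Finset.Iio j)
    (by simp)]
  rw [norm_prod, Finset.prod_range]
  refine Finset.prod_congr rfl fun j _ => ?_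
  rw [norm_prod, norm_eval_lejaPoly]
  symm
  refine Finset.prod_bij (fun i _ => (i : ℕ)) ?_ ?_ ?_ ?_
  · simp
  · intro a _ b _ h; exact Fin.ext h
  · intro b hb
    have hb := Finset.mem_range.1 hb
    exact ⟨⟨b, hb.trans j.2⟩, by simpa [Fin.lt_def] using hb, rfl⟩
  · simp

theorem prod_norm_eval_lejaPoly_le_factorial {z : ℕ → ℂ} (hz : ∀ k, ‖z k‖ = 1) (N : ℕ) :
    ∏ n ∈ Finset.range N, ‖(lejaPoly z n).eval (z n)‖ ≤ N.factorial := by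
  rw [prod_norm_eval_lejaPoly_eq_norm_det_vandermonde]
  refine Matrix.norm_det_le_factorial fun i j => ?_
  simp [Matrix.vandermonde_apply, hz]

open ComplexConjugate in
theorem norm_one_sub_mul_conj {a w : ℂ} (ha : ‖a‖ = 1) : ‖1 - w * conj a‖ = ‖w - a‖ := by
  have h : a * conj a = 1 := by rw [Complex.mul_conj']; simp [ha]
  calc ‖1 - w * conj a‖ = ‖a‖ * ‖1 - w * conj a‖ := by rw [ha, one_mul]
    _ = ‖a - w * (a * conj a)‖ := by rw [← norm_mul]; ring_nf
    _ = ‖w - a‖ := by rw [h, mul_one, norm_sub_rev]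

open ComplexConjugate in
theorem norm_prod_one_sub_mul_conj_le {z : ℕ → ℂ} (hz : ∀ k, ‖z k‖ = 1) {n : ℕ} {M : ℝ}
    (hM : ∀ w ∈ Metric.sphere (0 : ℂ) 1, ‖(lejaPoly z n).eval w‖ ≤ M)
    {w : ℂ} (hw : w ∈ Metric.closedBall (0 : ℂ) 1) :
    ‖∏ k ∈ Finset.range n, (1 - w * conj (z k))‖ ≤ M := by
  refine Complex.norm_le_of_forall_mem_frontier_norm_le (U := Metric.ball 0 1)
    (f := fun w => ∏ k ∈ Finset.range n, (1 - w * conj (z k))) Metric.isBounded_ball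
    (Differentiable.diffContOnCl (by fun_prop)) (fun v hv => ?_) (by rwa [closure_ball _ one_ne_zero])
  rw [frontier_ball _ one_ne_zero] at hv
  refine le_of_eq_of_le ?_ (hM v hv)
  rw [norm_eval_lejaPoly, norm_prod]
  exact Finset.prod_congr rfl fun k _ => norm_one_sub_mul_conj (hz k)

theorem one_le_of_norm_eval_lejaPoly_le {z : ℕ → ℂ} (hz : ∀ k, ‖z k‖ = 1) {n : ℕ} {M : ℝ}
    (hM : ∀ w ∈ Metric.sphere (0 : ℂ) 1, ‖(lejaPoly z n).eval w‖ ≤ M) : 1 ≤ M := by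
  simpa using norm_prod_one_sub_mul_conj_le hz hM (w := 0) (by simp)

open ComplexConjugate in
theorem re_one_sub_mul_conj_pos {a w : ℂ} (ha : ‖a‖ = 1) (hw : w ∈ Metric.ball (0 : ℂ) 1) :
    0 < (1 - w * conj a).re := by
  have h : (w * conj a).re < 1 := by
    refine (Complex.re_le_norm _).trans_lt ?_
    simpa [ha] using hw
  simpa using h

theorem abs_sum_arg_le {ι : Type*} (s : Finset ι) {f : ι → ℂ} (hf : ∀ i ∈ s, 0 ≤ (f i).re) :
    |∑ i ∈ s, (f i).arg| ≤ s.card * (Real.pi / 2) := by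
  rw [← nsmul_eq_mul]
  exact (Finset.abs_sum_le_sum_abs _ _).trans
    (Finset.sum_le_card_nsmul _ _ _ fun i hi => Complex.abs_arg_le_pi_div_two_iff.2 (hf i hi))

open ComplexConjugate in
theorem circleAverage_abs_sum_arg_le {z : ℕ → ℂ} (hz : ∀ k, ‖z k‖ = 1) {n : ℕ} {M δ r : ℝ}
    (hM : ∀ w ∈ Metric.sphere (0 : ℂ) 1, ‖(lejaPoly z n).eval w‖ ≤ M) (hr : |r| < 1)
    (h0 : 0 < δ) (h1 : δ ≤ 1) :
    Real.circleAverage (fun w => |∑ k ∈ Finset.range n, (1 - w * conj (z k)).arg|) 0 r ≤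
      (n * (Real.pi / 2)) ^ δ * ((1 + Real.log M) ^ (1 - δ) / δ) := by
  have hM1 := one_le_of_norm_eval_lejaPoly_le hz hM
  have hpos : ∀ k, ∀ w ∈ Metric.ball (0 : ℂ) 1, 0 < (1 - w * conj (z k)).re :=
    fun k w hw => re_one_sub_mul_conj_pos (hz k) hw
  set G : ℂ → ℂ := fun w => ((1 + Real.log M : ℝ) : ℂ) -
    ∑ k ∈ Finset.range n, Complex.log (1 - w * conj (z k)) with hG
  have him : ∀ w, |(G w).im| = |∑ k ∈ Finset.range n, (1 - w * conj (z k)).arg| := fun w => by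
    rw [hG, Complex.sub_im, Complex.ofReal_im, zero_sub, abs_neg, Complex.im_sum]
    simp only [Complex.log_im]
  simp only [← him]
  refine circleAverage_abs_im_le hr ?_ (fun w hw => ?_) (by linarith [Real.log_nonneg hM1])
    ?_ h0 h1 fun w hw => ?_
  · refine (differentiableOn_const _).sub (DifferentiableOn.fun_sum fun k _ => ?_)
    exact DifferentiableOn.clog (by fun_prop) fun w hw => Or.inl (hpos k w hw)
  · have hne : ∀ k, 1 - w * conj (z k) ≠ 0 := fun k h => by
      have := hpos k w hw
      simp [h] at this
    have : ∑ k ∈ Finset.range n, Real.log ‖1 - w * conj (z k)‖ ≤ Real.log M := by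
      rw [← Real.log_prod fun k _ => norm_ne_zero_iff.2 (hne k), ← norm_prod]
      exact Real.log_le_log (norm_pos_iff.2 (Finset.prod_ne_zero_iff.2 fun k _ => hne k))
        (norm_prod_one_sub_mul_conj_le hz hM (Metric.ball_subset_closedBall hw))
    rw [hG, Complex.sub_re, Complex.ofReal_re, Complex.re_sum]
    simp only [Complex.log_re]
    linarith
  · simp [hG]
  · rw [him]
    simpa using abs_sum_arg_le (Finset.range n) fun k _ => (hpos k w hw).le

open ComplexConjugate in
theorem mul_integral_abs_sum_sawtooth_le {z : ℕ → ℂ} {x : ℕ → ℝ}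
    (hx : ∀ k, z k = Complex.exp (2 * Real.pi * Complex.I * x k)) {n : ℕ} {M δ : ℝ}
    (hM : ∀ w ∈ Metric.sphere (0 : ℂ) 1, ‖(lejaPoly z n).eval w‖ ≤ M)
    (h0 : 0 < δ) (h1 : δ ≤ 1) :
    Real.pi * ∫ t in (0 : ℝ)..1, |∑ k ∈ Finset.range n, sawtooth (t - x k)| ≤
      (n * (Real.pi / 2)) ^ δ * ((1 + Real.log M) ^ (1 - δ) / δ) := by
  have hz : ∀ k, ‖z k‖ = 1 := fun k => by
    rw [hx, show 2 * (Real.pi : ℂ) * Complex.I * x k = ((2 * Real.pi * x k : ℝ) : ℂ) * Complex.I by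
      push_cast; ring, Complex.norm_exp_ofReal_mul_I]
  have hmul : ∀ (t : ℝ) (k : ℕ), Complex.exp (2 * Real.pi * Complex.I * t) * conj (z k) =
      Complex.exp (2 * Real.pi * Complex.I * (t - x k : ℝ)) := fun t k => by
    rw [hx, ← Complex.exp_conj, ← Complex.exp_add]
    congr 1
    simp only [map_mul, Complex.conj_ofReal, Complex.conj_I, map_ofNat]
    push_cast
    ring
  set F : ℝ → ℝ → ℝ := fun r t =>
    |∑ k ∈ Finset.range n, (1 - r * Complex.exp (2 * Real.pi * Complex.I * t) * conj (z k)).arg|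
    with hF
  have hball : ∀ {r : ℝ}, r ∈ Set.Ioo (0 : ℝ) 1 → ∀ t : ℝ,
      r * Complex.exp (2 * Real.pi * Complex.I * t) ∈ Metric.ball (0 : ℂ) 1 := fun {r} hr t => by
    rw [show 2 * (Real.pi : ℂ) * Complex.I * t = ((2 * Real.pi * t : ℝ) : ℂ) * Complex.I by
      push_cast; ring]
    simp only [mem_ball_zero_iff, norm_mul, Complex.norm_real, Complex.norm_exp_ofReal_mul_I]
    simpa [abs_of_pos hr.1] using hr.2
  have hev : ∀ᶠ r in nhdsWithin (1 : ℝ) (Set.Iio 1), r ∈ Set.Ioo (0 : ℝ) 1 :=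
    Ioo_mem_nhdsLT one_pos
  have hlim : Filter.Tendsto (fun r => ∫ t in (0 : ℝ)..1, F r t) (nhdsWithin 1 (Set.Iio 1))
      (nhds (∫ t in (0 : ℝ)..1, |∑ k ∈ Finset.range n, -Real.pi * sawtooth (t - x k)|)) := by
    refine intervalIntegral.tendsto_integral_filter_of_dominated_convergence
      (fun _ => n * (Real.pi / 2)) ?_ ?_ intervalIntegrable_const ?_
    · filter_upwards [hev] with r hr
      refine Measurable.aestronglyMeasurable ?_
      refine Measurable.abs (Finset.measurable_fun_sum _ fun k _ => ?_)
      exact Complex.measurable_arg.comp (by fun_prop)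
    · filter_upwards [hev] with r hr
      refine Filter.Eventually.of_forall fun t _ => ?_
      rw [Real.norm_eq_abs, hF, abs_abs]
      simpa using abs_sum_arg_le (Finset.range n) fun k _ =>
        (re_one_sub_mul_conj_pos (hz k) (hball hr t)).le
    · have hae : ∀ᵐ t : ℝ, ∀ k, Int.fract (t - x k) ≠ 0 := by
        refine MeasureTheory.ae_all_iff.2 fun k => ?_
        refine (Set.Countable.ae_notMem (Set.countable_range fun i : ℤ => (i : ℝ) + x k)
          MeasureTheory.volume).mono fun t ht h => ht ?_
        obtain ⟨i, hi⟩ := Int.fract_eq_zero_iff.1 h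
        exact ⟨i, by simp only; linarith⟩
      filter_upwards [hae] with t ht _
      refine (tendsto_finsetSum _ fun k _ => ?_).abs
      rw [← Complex.arg_one_sub_exp (ht k)]
      refine (Complex.continuousAt_arg (Complex.one_sub_exp_mem_slitPlane (ht k))).tendsto.comp ?_
      have hc : Continuous fun r : ℝ =>
          1 - (r : ℂ) * Complex.exp (2 * Real.pi * Complex.I * t) * conj (z k) := by fun_prop
      have := (hc.tendsto 1).mono_left (nhdsWithin_le_nhds (s := Set.Iio 1))
      rwa [Complex.ofReal_one, one_mul, hmul] at this
  have heq : ∫ t in (0 : ℝ)..1, |∑ k ∈ Finset.range n, -Real.pi * sawtooth (t - x k)| =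
      Real.pi * ∫ t in (0 : ℝ)..1, |∑ k ∈ Finset.range n, sawtooth (t - x k)| := by
    rw [← intervalIntegral.integral_const_mul]
    refine intervalIntegral.integral_congr fun t _ => ?_
    simp only [← Finset.mul_sum, abs_mul, abs_neg, abs_of_pos Real.pi_pos]
  rw [← heq]
  refine le_of_tendsto hlim ?_
  filter_upwards [hev] with r hr
  refine le_of_eq_of_le ?_
    (circleAverage_abs_sum_arg_le hz hM (by rw [abs_of_pos hr.1]; exact hr.2) h0 h1)
  rw [circleAverage_eq_integral_unitInterval]

theorem integral_abs_sum_sawtooth_le {z : ℕ → ℂ} {x : ℕ → ℝ}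
    (hx : ∀ k, z k = Complex.exp (2 * Real.pi * Complex.I * x k)) {n N : ℕ} {M : ℝ}
    (hM : ∀ w ∈ Metric.sphere (0 : ℂ) 1, ‖(lejaPoly z n).eval w‖ ≤ M) (hM1 : 1 ≤ M)
    (hN : 1 ≤ Real.log N) (hn : n ≤ N) :
    ∫ t in (0 : ℝ)..1, |∑ k ∈ Finset.range n, sawtooth (t - x k)| ≤
      2 * Real.log N * (1 + Real.log M) := by
  set L := Real.log N with hL
  have hpi := Real.pi_gt_three
  have hL0 : 0 < L := one_pos.trans_le hN
  have hδ0 : 0 < L⁻¹ := inv_pos.2 hL0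
  have hδ1 : L⁻¹ ≤ 1 := inv_le_one_of_one_le₀ hN
  have hN0 : (0 : ℝ) < N := by
    rcases Nat.eq_zero_or_pos N with h | h
    · simp [hL, h] at hL0
    · exact_mod_cast h
  have key := mul_integral_abs_sum_sawtooth_le hx hM hδ0 hδ1
  have hlogM := Real.log_nonneg hM1
  have h1 : (n * (Real.pi / 2)) ^ L⁻¹ ≤ Real.exp 1 * (Real.pi / 2) := by
    rw [Real.mul_rpow (by positivity) (by positivity)]
    gcongr
    · calc (n : ℝ) ^ L⁻¹ ≤ (N : ℝ) ^ L⁻¹ := by gcongr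
        _ = Real.exp 1 := by
          rw [Real.rpow_def_of_pos hN0, ← hL, mul_inv_cancel₀ hL0.ne']
    · exact Real.rpow_le_self_of_one_le (by linarith) hδ1
  have h2 : (1 + Real.log M) ^ (1 - L⁻¹) / L⁻¹ ≤ (1 + Real.log M) * L := by
    rw [div_inv_eq_mul]
    gcongr
    exact Real.rpow_le_self_of_one_le (by linarith) (by linarith)
  have h3 : (n * (Real.pi / 2)) ^ L⁻¹ * ((1 + Real.log M) ^ (1 - L⁻¹) / L⁻¹) ≤
      Real.exp 1 * (Real.pi / 2) * ((1 + Real.log M) * L) :=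
    mul_le_mul h1 h2 (by positivity) (by positivity)
  have he := Real.exp_one_lt_d9
  have hY : 0 ≤ (1 + Real.log M) * L := by positivity
  refine le_of_mul_le_mul_left ((key.trans h3).trans ?_) Real.pi_pos
  calc Real.exp 1 * (Real.pi / 2) * ((1 + Real.log M) * L)
      ≤ 4 * (Real.pi / 2) * ((1 + Real.log M) * L) := by gcongr; linarith
    _ = _ := by ring

theorem mul_normL1_sawtoothMean (x : ℕ → ℝ) {n : ℕ} (hn : n ≠ 0) :
    n * normL1 (sawtoothMean x n) =
      ∫ t in (0 : ℝ)..1, |∑ k ∈ Finset.range n, sawtooth (t - x k)| := by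
  rw [normL1, ← intervalIntegral.integral_const_mul]
  refine intervalIntegral.integral_congr fun t _ => ?_
  have : (n : ℝ) ≠ 0 := by exact_mod_cast hn
  simp only [sawtoothMean, abs_mul, abs_div, abs_one, Nat.abs_cast]
  field_simp

namespace IsLejaSequence

variable {m : ℕ} {z : ℕ → ℂ}

theorem norm_eq_one (h : IsLejaSequence m z) (k : ℕ) : ‖z k‖ = 1 := by
  simpa using h.mem_circle k

theorem norm_eval_le (h : IsLejaSequence m z) {n : ℕ} (hn : m ≤ n) :
    ∀ w ∈ Metric.sphere (0 : ℂ) 1, ‖(lejaPoly z n).eval w‖ ≤ ‖(lejaPoly z n).eval (z n)‖ :=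
  fun _ hw => h.greedy n hn hw

theorem one_le_norm_eval (h : IsLejaSequence m z) {n : ℕ} (hn : m ≤ n) :
    1 ≤ ‖(lejaPoly z n).eval (z n)‖ :=
  one_le_of_norm_eval_lejaPoly_le h.norm_eq_one (h.norm_eval_le hn)

theorem norm_eval_pos (h : IsLejaSequence m z) (n : ℕ) : 0 < ‖(lejaPoly z n).eval (z n)‖ := by
  rcases le_or_gt m n with hn | hn
  · exact one_pos.trans_le (h.one_le_norm_eval hn)
  · rw [norm_eval_lejaPoly]
    refine Finset.prod_pos fun k hk => norm_pos_iff.2 (sub_ne_zero.2 fun heq => ?_)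
    have hk := Finset.mem_range.1 hk
    exact hk.ne' (h.distinct (Set.mem_Iio.2 hn) (Set.mem_Iio.2 (hk.trans hn)) heq)

theorem sum_log_norm_eval_le (h : IsLejaSequence m z) (N : ℕ) :
    ∑ n ∈ Finset.range N, Real.log ‖(lejaPoly z n).eval (z n)‖ ≤ N * Real.log N := by
  rw [← Real.log_prod fun n _ => (h.norm_eval_pos n).ne', ← Real.log_pow]
  refine Real.log_le_log (Finset.prod_pos fun n _ => h.norm_eval_pos n) ?_
  refine (prod_norm_eval_lejaPoly_le_factorial h.norm_eq_one N).trans ?_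
  exact_mod_cast Nat.factorial_le_pow N

end IsLejaSequence

theorem theorem2 :
    ∃ C : ℝ, 0 < C ∧
      ∀ (m : ℕ) (_ : 1 ≤ m) (z : ℕ → ℂ) (_ : IsLejaSequence m z)
        (x : ℕ → ℝ) (_ : ∀ k, x k ∈ Set.Icc (0 : ℝ) 1)
        (_ : ∀ k, z k = Complex.exp (2 * Real.pi * Complex.I * x k)),
        ∃ N₀ : ℕ, ∀ N : ℕ, N₀ ≤ N →
          (1 / (N : ℝ)) * ∑ n ∈ Finset.Icc 1 N, (n : ℝ) * normL1 (sawtoothMean x n)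
            ≤ C * (Real.log N) ^ 2 := by
  refine ⟨15, by norm_num, fun m _ z hz x _ hx => ?_⟩
  set a : ℕ → ℝ := fun n => ∫ t in (0 : ℝ)..1, |∑ k ∈ Finset.range n, sawtooth (t - x k)| with ha
  set b : ℕ → ℝ := fun n => Real.log ‖(lejaPoly z n).eval (z n)‖ with hb
  set K₀ := ∑ n ∈ Finset.range m, a n with hK₀
  set K₁ := ∑ n ∈ Finset.range m, b n with hK₁
  refine ⟨max (max 3 m) (max ⌈K₀⌉₊ ⌈-K₁⌉₊), fun N hN => ?_⟩
  simp only [max_le_iff] at hN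
  obtain ⟨⟨hN3, hNm⟩, hNK₀, hNK₁⟩ := hN
  have hNR : (3 : ℝ) ≤ N := by exact_mod_cast hN3
  have hN0 : (0 : ℝ) < N := by linarith
  have hL : 1 ≤ Real.log N := by
    rw [Real.le_log_iff_exp_le hN0]
    linarith [Real.exp_one_lt_d9]
  have hsum : ∑ n ∈ Finset.Icc 1 N, (n : ℝ) * normL1 (sawtoothMean x n) =
      K₀ + ∑ n ∈ Finset.Ico m (N + 1), a n := by
    rw [hK₀, Finset.sum_range_add_sum_Ico _ (by omega), Finset.sum_range_succ',
      show a 0 = 0 by simp [ha], add_zero, Finset.range_eq_Ico, Finset.sum_Ico_add' a 0 N 1]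
    exact Finset.sum_congr rfl fun n hn =>
      mul_normL1_sawtoothMean x (by have := Finset.mem_Icc.1 hn; omega)
  have hIco : ∑ n ∈ Finset.Ico m (N + 1), a n ≤
      2 * Real.log N * (((N + 1 : ℕ) : ℝ) + ∑ n ∈ Finset.Ico m (N + 1), b n) := by
    calc ∑ n ∈ Finset.Ico m (N + 1), a n
        ≤ ∑ n ∈ Finset.Ico m (N + 1), 2 * Real.log N * (1 + b n) := by
          refine Finset.sum_le_sum fun n hn => ?_
          obtain ⟨h1, h2⟩ := Finset.mem_Ico.1 hn
          exact integral_abs_sum_sawtooth_le hx (hz.norm_eval_le h1) (hz.one_le_norm_eval h1) hL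
            (by omega)
      _ ≤ _ := by
          rw [← Finset.mul_sum, Finset.sum_add_distrib, Finset.sum_const, nsmul_one, Nat.card_Ico]
          gcongr
          omega
  have hb' : K₁ + ∑ n ∈ Finset.Ico m (N + 1), b n ≤ (N + 1 : ℕ) * Real.log (N + 1 : ℕ) := by
    rw [hK₁, Finset.sum_range_add_sum_Ico _ (by omega)]
    exact hz.sum_log_norm_eval_le (N + 1)
  have hlog : Real.log (N + 1 : ℕ) ≤ 2 * Real.log N := by
    have : Real.log ((N : ℝ) ^ 2) = 2 * Real.log N := by rw [Real.log_pow]; norm_num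
    rw [← this]
    refine Real.log_le_log (by positivity) ?_
    push_cast
    nlinarith
  have hK₀N : K₀ ≤ N := Nat.ceil_le.1 hNK₀
  have hK₁N : -K₁ ≤ N := Nat.ceil_le.1 hNK₁
  have hN1 : ((N + 1 : ℕ) : ℝ) ≤ 2 * N := by push_cast; linarith
  have hprod : ((N + 1 : ℕ) : ℝ) * Real.log (N + 1 : ℕ) ≤ 2 * N * (2 * Real.log N) := by
    gcongr
  rw [hsum, one_div, inv_mul_le_iff₀ hN0]
  generalize Real.log N = L at *
  have hmain : 2 * L * (((N + 1 : ℕ) : ℝ) + ∑ n ∈ Finset.Ico m (N + 1), b n) ≤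
      2 * L * (3 * N + 4 * N * L) :=
    mul_le_mul_of_nonneg_left (by linarith) (by linarith)
  have hNL : (N : ℝ) ≤ N * L := le_mul_of_one_le_right hN0.le hL
  have hNLL : N * L ≤ N * L * L := le_mul_of_one_le_right (by positivity) hL
  linarith
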